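/- Identify $P(\mathbb N)$ with the Cantor space $\{0,1\}^{\mathbb N}$ via characteristic functions; let $[\mathbb N]^\infty$ be the set of infinite subsets of $\mathbb N$, whose elements are also viewed as strictly increasing functions $\mathbb N\to\mathbb N$, and let $\mathrm{Fin}$ be the set of finite subsets of $\mathbb N$. For an uncountable ordinal number $\kappa$, a set $X\subseteq[\mathbb N]^\infty$ with $|X|\ge\kappa$ is a *$\kappa$-generalized tower* if for each (strictly increasing) function $a\in[\mathbb N]^\infty$ there are sets $b\in[\mathbb N]^\infty$ and $S\subseteq X$ with $|S|<\kappa$ such that $x\cap\bigcup_{n\in b}[a(n),a(n+1))$ is finite for all $x\in X\setminus S$. A *$\kappa$-generalized tower set* is a subspace $X\cup\mathrm{Fin}$ of $P(\mathbb N)$, where $X$ is a $\kappa$-generalized tower. (Cardinals are identified with initial ordinals.) A *set of reals* is a space homeomorphic to a subspace of $\mathbb R$. An *open cover* of a space is a family of proper open subsets whose union is the whole space. An *$\omega$-cover* is an open cover such that each finite subset of the space is contained in a member of the cover. A *$\gamma$-cover* is an infinite open cover such that each point of the space belongs to all but finitely many members of the cover. A space satisfies *$\gamma$* if every $\omega$-cover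 of the space contains a $\gamma$-cover of the space. A space satisfies $\mathsf S_1(\Omega,\Omega)$ if for each sequence $\mathcal U_1,\mathcal U_2,\dots$ of $\omega$-covers of the space there are $U_1\in\mathcal U_1,U_2\in\mathcal U_2,\dots$ such that $\{U_n : n\in\mathbb N\}$ is an $\omega$-cover of the space. Let $\mathrm{cov}(\mathcal M)$ be the minimal cardinality of a family of meager subsets of the Baire space $\mathbb N^{\mathbb N}$ that covers $\mathbb N^{\mathbb N}$. **Theorem.** Let $\kappa$ be an uncountable ordinal number with $\kappa\le\mathrm{cov}(\mathcal M)$ such that $\kappa$ is regular or $\kappa<\mathrm{cov}(\mathcal M)$. Then the product space of finitely many $\kappa$-generalized tower sets and a set of reals satisfying $\gamma$ satisfies $\mathsf S_1(\Omega,\Omega)$. -/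

import Mathlib

open Set
open scoped Cardinal

/-- A set of reals: a space homeomorphic to a subspace of the real line. -/
def IsSetOfReals (X : Type*) [TopologicalSpace X] : Prop :=
  ∃ f : X → ℝ, Topology.IsEmbedding f

/-- An open cover of a space `X`: a family of proper open subsets of `X` whose union is `X`. -/
def IsProperOpenCover (X : Type*) [TopologicalSpace X] (U : Set (Set X)) : Prop :=
  (∀ A ∈ U, IsOpen A ∧ A ≠ univ) ∧ ⋃₀ U = univ

/-- `Ω(X)`: the family of all `ω`-covers of `X`, that is, open covers such that each finite subset
of `X` is contained in a member of the cover. -/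
def OmegaCovers (X : Type*) [TopologicalSpace X] : Set (Set (Set X)) :=
  {U | IsProperOpenCover X U ∧ ∀ F : Set X, F.Finite → ∃ A ∈ U, F ⊆ A}

/-- `Γ(X)`: the family of all open `γ`-covers of `X`, that is, infinite open covers such that each
point of `X` belongs to all but finitely many members of the cover. -/
def GammaCovers (X : Type*) [TopologicalSpace X] : Set (Set (Set X)) :=
  {U | IsProperOpenCover X U ∧ U.Infinite ∧ ∀ x : X, {A ∈ U | x ∉ A}.Finite}

/-- The Gerlits--Nagy property `γ`: every `ω`-cover contains a `γ`-cover. -/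
def HasGamma (X : Type*) [TopologicalSpace X] : Prop :=
  ∀ U ∈ OmegaCovers X, ∃ V ⊆ U, V ∈ GammaCovers X

/-- The selection principle `S₁(𝒜, ℬ)` for families `𝒜`, `ℬ` of covers of `X`. -/
def SelectOne {X : Type*} (𝒜 ℬ : Set (Set (Set X))) : Prop :=
  ∀ U : ℕ → Set (Set X), (∀ n, U n ∈ 𝒜) →
    ∃ V : ℕ → Set X, (∀ n, V n ∈ U n) ∧ range V ∈ ℬ

/-- `cov(ℳ)`: the minimal cardinality of a family of meager subsets of the Baire space
that covers the Baire space. -/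
noncomputable def covMeager : Cardinal.{0} :=
  sInf {c | ∃ F : Set (Set (ℕ → ℕ)), (∀ A ∈ F, IsMeagre A) ∧ ⋃₀ F = univ ∧ #F = c}

/-- `X ⊆ [ℕ]^∞` is a `κ`-generalized tower, for an ordinal number `κ`. Elements `a ∈ [ℕ]^∞` in the
role of functions are given as strictly increasing functions, and a cardinal is compared with `κ`
through its initial ordinal. -/
def IsGeneralizedTower (κ : Ordinal.{0}) (X : Set (Set ℕ)) : Prop :=
  (∀ x ∈ X, x.Infinite) ∧ κ ≤ (#X).ord ∧
    ∀ a : ℕ → ℕ, StrictMono a →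
      ∃ b : Set ℕ, b.Infinite ∧ ∃ S ⊆ X, (#S).ord < κ ∧
        ∀ x ∈ X \ S, (x ∩ ⋃ n ∈ b, Ico (a n) (a (n + 1))).Finite

/-- The set `X ∪ Fin`, as a subset of the Cantor space `ℕ → Bool`, where a point `f` of the Cantor
space is identified with the set `{n | f n = true}`. -/
def withFin (X : Set (Set ℕ)) : Set (ℕ → Bool) :=
  {f | {n | f n = true} ∈ X ∪ {s | s.Finite}}

open Filter Topology

/-! Replace `κ` by a regular uncountable `μ ≤ cov(ℳ)`. For each finite set `T` of prescribed
coordinates, selections `g_T` on an infinite set `A_T` capture almost always every point whose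
coordinates lie in `T` or outside an exceptional set `S_T` of size below `μ`
(`exists_pointCofinite_selection`). These come from compactness in the Cantor coordinates, the
property γ of `Y`, and the tower property for a sufficiently sparse sequence. Regularity gives a set
`C` of size below `μ` with `S_T ⊆ C` for all finite `T ⊆ C`. There are fewer than `cov(ℳ)` such `T`,
so one `f` agrees with each `g_T` infinitely often on `A_T`. For a finite set `F` of points, let `T`
be the coordinates of `F` in `C`: the others avoid `S_T`, so `f` selects a member containing `F`. -/

/-! ### The property γ and common intervals -/

/-- If `Y` has the Gerlits--Nagy property, then infinitely many members of a sequence of open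
families, each covering all finite sets, admit selections forming a point-cofinite family. -/
theorem HasGamma.exists_partial_selection {Y : Type*} [TopologicalSpace Y] [T1Space Y]
    (hY : HasGamma Y) (W : ℕ → Set (Set Y)) (hWo : ∀ n, ∀ A ∈ W n, IsOpen A)
    (hW : ∀ n, ∀ F : Set Y, F.Finite → ∃ A ∈ W n, F ⊆ A) :
    ∃ (D : Set ℕ) (g : ℕ → Set Y), D.Infinite ∧ (∀ n, g n ∈ W n) ∧
      ∀ y, {n ∈ D | y ∉ g n}.Finite := by
  cases finite_or_infinite Y with
  | inl hfin =>
    -- A finite space has no ω-covers, so γ says nothing here; instead some member of each family is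
    -- the whole space.
    choose g hg hg' using fun n => hW n univ finite_univ
    refine ⟨univ, g, infinite_univ, hg, fun y => ?_⟩
    convert finite_empty
    ext n
    simpa using hg' n (mem_univ y)
  | inr hinf =>
    let p := Infinite.natEmbedding Y
    -- Deleting `p n` makes members proper and tags their index: all those from `W n` miss `p n`, so
    -- a γ-cover takes only finitely many from each `W n`.
    let U : Set (Set Y) := {V | ∃ n, ∃ A ∈ W n, V = A \ {p n}}
    have hUfin : ∀ F : Set Y, F.Finite → ∃ A ∈ U, F ⊆ A := by
      intro F hF
      obtain ⟨n, hn⟩ := (hF.preimage p.injective.injOn).exists_notMem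
      obtain ⟨A, hA, hFA⟩ := hW n F hF
      exact ⟨_, ⟨n, A, hA, rfl⟩, subset_sdiff_singleton hFA hn⟩
    have hU : U ∈ OmegaCovers Y := by
      refine ⟨⟨?_, ?_⟩, hUfin⟩
      · rintro _ ⟨n, A, hA, rfl⟩
        refine ⟨(hWo n A hA).sdiff isClosed_singleton, fun h => ?_⟩
        have := h ▸ mem_univ (p n)
        exact this.2 rfl
      · refine eq_univ_of_forall fun y => ?_
        obtain ⟨A, hA, hy⟩ := hUfin {y} (finite_singleton y)
        exact ⟨A, hA, hy rfl⟩
    obtain ⟨V, hVU, -, hVinf, hVpt⟩ := hY U hU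
    have hVU' : ∀ v ∈ V, ∃ n, ∃ A ∈ W n, v = A \ {p n} := hVU
    choose! idx A hA hVA using hVU'
    have hD : (idx '' V).Infinite := by
      intro hfin
      refine hVinf (Finite.of_finite_fibers idx hfin fun n _ => (hVpt (p n)).subset ?_)
      rintro v ⟨hv, hn⟩
      refine ⟨hv, fun h => ?_⟩
      rw [hVA v hv, show idx v = n from hn] at h
      exact h.2 rfl
    choose! v hv hvidx using fun n (hn : n ∈ idx '' V) => (mem_image _ _ _).1 hn
    choose g₀ hg₀ _ using fun n => hW n ∅ finite_empty
    classical
    refine ⟨idx '' V, fun n => if n ∈ idx '' V then A (v n) else g₀ n, hD, fun n => ?_, fun y => ?_⟩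
    · dsimp only
      split_ifs with h
      · have := hA (v n) (hv n h)
        rwa [hvidx n h] at this
      · exact hg₀ n
    · refine Finite.of_finite_image (f := v) ((hVpt y).subset ?_) ?_
      · rintro _ ⟨n, ⟨hn, hy⟩, rfl⟩
        refine ⟨hv n hn, fun hy' => hy ?_⟩
        beta_reduce
        rw [if_pos hn]
        rw [hVA _ (hv n hn)] at hy'
        exact hy'.1
      · intro a ha b hb hab
        rw [← hvidx a ha.1, ← hvidx b hb.1, hab]

/-- For finitely many families avoiding many intervals of any `a`, up to fewer than `μ` exceptions,
one infinite set of intervals of `a` serves all of them. -/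
theorem exists_common_intervals {ι : Type*} {μ : Cardinal.{0}} (hμ : ℵ₀ ≤ μ)
    (X : ι → Set (Set ℕ))
    (hX : ∀ i, ∀ a : ℕ → ℕ, StrictMono a → ∃ b : Set ℕ, b.Infinite ∧ ∃ S : Set (Set ℕ), #S < μ ∧
        ∀ x ∈ X i \ S, (x ∩ ⋃ n ∈ b, Ico (a n) (a (n + 1))).Finite)
    (s : Finset ι) (a : ℕ → ℕ) (ha : StrictMono a) :
    ∃ b : Set ℕ, b.Infinite ∧ ∃ S : Set (Set ℕ), #S < μ ∧
      ∀ i ∈ s, ∀ x ∈ X i \ S, (x ∩ ⋃ n ∈ b, Ico (a n) (a (n + 1))).Finite := by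
  classical
  induction s using Finset.induction_on with
  | empty => exact ⟨univ, infinite_univ, ∅, by simpa using Cardinal.aleph0_pos.trans_le hμ, by simp⟩
  | insert j s _ ih =>
    obtain ⟨b, hb, S, hS, hbS⟩ := ih
    have he := Nat.nth_strictMono hb
    -- Along the subsequence of `a` indexed by `b`, each new interval contains the old interval
    -- starting at the same point.
    obtain ⟨b', hb', S', hS', hbS'⟩ := hX j (fun n => a (Nat.nth (· ∈ b) n)) (ha.comp he)
    refine ⟨Nat.nth (· ∈ b) '' b', hb'.image he.injective.injOn, S ∪ S',
      (Cardinal.mk_union_le _ _).trans_lt (Cardinal.add_lt_of_lt hμ hS hS'), ?_⟩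
    intro i hi x hx
    rcases Finset.mem_insert.1 hi with rfl | hi
    · refine (hbS' x ⟨hx.1, fun h => hx.2 (.inr h)⟩).subset (inter_subset_inter_right _ ?_)
      simp only [biUnion_image]
      refine iUnion₂_mono fun n _ => Ico_subset_Ico_right (ha.monotone ?_)
      exact he (Nat.lt_succ_self n)
    · refine (hbS i hi x ⟨hx.1, fun h => hx.2 (.inl h)⟩).subset (inter_subset_inter_right _ ?_)
      refine biUnion_subset_biUnion_left ?_
      rintro _ ⟨n, _, rfl⟩
      exact Nat.nth_mem_of_infinite hb n

/-! ### Category, cardinals and countable subcovers -/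

/-- The functions agreeing with `g` only finitely often on an infinite set form a meager set. -/
theorem isMeagre_setOf_finite_agreement {A : Set ℕ} (hA : A.Infinite) (g : ℕ → ℕ) :
    IsMeagre {f : ℕ → ℕ | {n ∈ A | f n = g n}.Finite} := by
  have key : ∀ N, (⋃ n ∈ {n ∈ A | N ≤ n}, {f : ℕ → ℕ | f n = g n}) ∈ residual (ℕ → ℕ) := by
    intro N
    refine residual_of_dense_open ?_ ?_
    · exact isOpen_biUnion fun n _ => (isOpen_discrete {g n}).preimage (continuous_apply (A := fun _ : ℕ => ℕ) n)
    · intro f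
      have ht : Tendsto (fun n => Function.update f n (g n)) (atTop ⊓ 𝓟 A) (𝓝 f) := by
        refine tendsto_pi_nhds.2 fun k => tendsto_const_nhds.congr' ?_
        filter_upwards [mem_inf_of_left (eventually_gt_atTop k)] with n hn
        rw [Function.update_of_ne hn.ne]
      have : (atTop ⊓ 𝓟 A).NeBot := by
        rw [← Nat.cofinite_eq_atTop]
        exact cofinite_inf_principal_neBot_iff.2 hA
      refine mem_closure_of_tendsto ht ?_
      filter_upwards [mem_inf_of_left (eventually_ge_atTop N), mem_inf_of_right (mem_principal_self A)]
        with n hn hnA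
      exact mem_biUnion (show n ∈ {n ∈ A | N ≤ n} from ⟨hnA, hn⟩) (by simp)
  refine mem_of_superset (countable_iInter_mem.2 key) fun f hf hfin => ?_
  obtain ⟨N, hN⟩ := hfin.bddAbove
  obtain ⟨n, ⟨hnA, hn⟩, hfn⟩ := mem_iUnion₂.1 (mem_iInter.1 hf (N + 1))
  exact absurd (hN ⟨hnA, hfn⟩) (by omega)

/-- Fewer than `cov(ℳ)` meager sets do not cover the Baire space. -/
theorem exists_notMem_of_card_lt_covMeager {ι : Type} (hι : #ι < covMeager) (M : ι → Set (ℕ → ℕ))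
    (hM : ∀ i, IsMeagre (M i)) : ∃ f, ∀ i, f ∉ M i := by
  by_contra! h
  refine (hι.trans_le ?_).not_ge (Cardinal.mk_range_le (f := M))
  refine csInf_le' ⟨range M, by rintro _ ⟨i, rfl⟩; exact hM i, ?_, rfl⟩
  exact eq_univ_of_forall fun f => let ⟨i, hi⟩ := h f; ⟨_, ⟨i, rfl⟩, hi⟩

theorem mk_finset_lt {α : Type*} {μ : Cardinal} (hμ : ℵ₀ < μ) (h : #α < μ) : #(Finset α) < μ := by
  cases finite_or_infinite α with
  | inl _ => exact (Cardinal.lt_aleph0_of_finite _).trans hμ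
  | inr _ => rwa [Cardinal.mk_finset_of_infinite]

/-- Closing off under small-valued functions of finite sets preserves smallness. -/
theorem exists_small_closed_set {α : Type} {μ : Cardinal} (hμ : μ.IsRegular) (hμ' : ℵ₀ < μ)
    (S : Finset α → Set α) (hS : ∀ T, #(S T) < μ) :
    ∃ C : Set α, #C < μ ∧ ∀ T : Finset α, ↑T ⊆ C → S T ⊆ C := by
  let next : Set α → Set α := fun C => C ∪ ⋃ T : Finset C, S (T.map (.subtype _))
  let st : ℕ → Set α := fun n => next^[n] ∅
  have hst : ∀ n, #(st n) < μ := by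
    intro n
    induction n with
    | zero => simpa [st] using hμ.pos
    | succ n ih =>
      simp only [st, Function.iterate_succ_apply']
      refine (Cardinal.mk_union_le _ _).trans_lt (Cardinal.add_lt_of_lt hμ'.le ih ?_)
      exact (Cardinal.card_iUnion_lt_iff_forall_of_isRegular hμ (mk_finset_lt hμ' ih)).2
        fun T => hS _
  have hmono : Monotone st := monotone_nat_of_le_succ fun n => by
    simp only [st, Function.iterate_succ_apply']
    exact subset_union_left
  refine ⟨⋃ n, st n, ?_, fun T hT => ?_⟩
  · exact (Cardinal.card_iUnion_lt_iff_forall_of_isRegular hμ (by simpa using hμ')).2 hst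
  · classical
    obtain ⟨n, hn⟩ := (hmono.directed_le).exists_mem_subset_of_finset_subset_biUnion hT
    refine Subset.trans ?_ (subset_iUnion st (n + 1))
    simp only [st, Function.iterate_succ_apply']
    refine Subset.trans ?_ subset_union_right
    refine Subset.trans ?_ (subset_iUnion _ (T.subtype (· ∈ st n)))
    rw [Finset.subtype_map_of_mem hn]

/-- In a second countable space every `ω`-cover contains a countable one. -/
theorem OmegaCovers.exists_enumerated_subcover {Z : Type*} [TopologicalSpace Z]
    [SecondCountableTopology Z] {U : Set (Set Z)} (hU : U ∈ OmegaCovers Z) :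
    ∃ u : ℕ → Set Z, (∀ n, u n ∈ U) ∧ ∀ F : Set Z, F.Finite → ∃ n, F ⊆ u n := by
  let B := TopologicalSpace.countableBasis Z
  have hB := TopologicalSpace.isBasis_countableBasis Z
  have : Countable B := TopologicalSpace.countable_countableBasis Z
  obtain ⟨A₀, hA₀, -⟩ := hU.2 ∅ finite_empty
  have : ∀ t : Finset B, ∃ A ∈ U, (∃ A' ∈ U, ⋃ b ∈ t, (b : Set Z) ⊆ A') → ⋃ b ∈ t, (b : Set Z) ⊆ A := by
    intro t
    by_cases h : ∃ A' ∈ U, ⋃ b ∈ t, (b : Set Z) ⊆ A'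
    · obtain ⟨A, hA, h'⟩ := h
      exact ⟨A, hA, fun _ => h'⟩
    · exact ⟨A₀, hA₀, fun h' => absurd h' h⟩
  choose c hcU hc using this
  obtain ⟨e, he⟩ := exists_surjective_nat (Finset B)
  refine ⟨c ∘ e, fun n => hcU _, fun F hF => ?_⟩
  obtain ⟨A, hA, hFA⟩ := hU.2 F hF
  have hex : ∀ z : F, ∃ b : B, ↑z ∈ (b : Set Z) ∧ (b : Set Z) ⊆ A := fun z => by
    obtain ⟨b, hb, hzb, hbA⟩ := hB.exists_subset_of_mem_open (hFA z.2) (hU.1.1 A hA).1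
    exact ⟨⟨b, hb⟩, hzb, hbA⟩
  choose b hzb hbA using hex
  classical
  have := hF.fintype
  obtain ⟨n, hn⟩ := he (Finset.univ.image b)
  have hsub : ⋃ i ∈ Finset.univ.image b, (i : Set Z) ⊆ A := by
    refine iUnion₂_subset fun i hi => ?_
    obtain ⟨z, -, rfl⟩ := Finset.mem_image.1 hi
    exact hbA z
  refine ⟨n, fun z hz => ?_⟩
  rw [Function.comp_apply, hn]
  refine hc _ ⟨A, hA, hsub⟩ ?_
  exact mem_biUnion (Finset.mem_image_of_mem b (Finset.mem_univ ⟨z, hz⟩)) (hzb ⟨z, hz⟩)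

/-- Take `μ = κ` if `κ` is regular, and otherwise the successor of its cardinality. -/
theorem exists_regular_bound {κ : Ordinal.{0}} (h₀ : ℵ₀ < κ.card) (hle : κ ≤ covMeager.ord)
    (hκ : κ.cof.ord = κ ∨ κ < covMeager.ord) :
    ∃ μ : Cardinal.{0}, μ.IsRegular ∧ ℵ₀ < μ ∧ μ ≤ covMeager ∧ ∀ c : Cardinal, c.ord < κ → c < μ := by
  rcases hκ with hκ | hκ
  · have h : κ.card = κ.cof := by rw [← hκ, Cardinal.card_ord, hκ]
    refine ⟨κ.cof, ⟨h ▸ h₀.le, by rw [hκ]⟩, h ▸ h₀, ?_, fun c hc => ?_⟩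
    · rwa [← Cardinal.ord_le_ord, hκ]
    · rwa [← Cardinal.ord_lt_ord, hκ]
  · refine ⟨Order.succ κ.card, Cardinal.isRegular_succ h₀.le, h₀.trans (Order.lt_succ _),
      Order.succ_le_of_lt (Cardinal.lt_ord.1 hκ), fun c hc => Order.lt_succ_of_le ?_⟩
    have := Ordinal.card_le_card hc.le
    rwa [Cardinal.card_ord] at this

/-! ### Compactness in the Cantor coordinates -/

/-- Sequences of subsets of `ℕ` whose `i`-th entry is in `T i` or misses `[k, l)`. -/
def missing {ι : Type*} (T : ι → Set (ℕ → Bool)) (k l : ℕ) : Set (ι → ℕ → Bool) :=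
  {x | ∀ i, x i ∈ T i ∨ ∀ j ∈ Ico k l, x i j = false}

theorem isClosed_missing {ι : Type*} {T : ι → Set (ℕ → Bool)} (hT : ∀ i, (T i).Finite) (k l : ℕ) :
    IsClosed (missing T k l) := by
  simp only [missing, ofPred_forall, ofPred_or]
  refine isClosed_iInter fun i => ((hT i).isClosed.preimage (continuous_apply i)).union ?_
  refine isClosed_iInter fun j => isClosed_iInter fun _ => ?_
  exact isClosed_eq ((continuous_apply j).comp (continuous_apply i)) continuous_const

theorem finite_iInter_missing {ι : Type*} [Finite ι] {T : ι → Set (ℕ → Bool)}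
    (hT : ∀ i, (T i).Finite) (k : ℕ) :
    (⋂ l, missing T k l) ⊆ {x | ∀ i, x i ∈ T i ∨ ∀ j, k ≤ j → x i j = false} ∧
    {x : ι → ℕ → Bool | ∀ i, x i ∈ T i ∨ ∀ j, k ≤ j → x i j = false}.Finite := by
  constructor
  · intro x hx i
    by_contra! h
    obtain ⟨hxi, j, hkj, hj⟩ := h
    rcases mem_iInter.1 hx (j + 1) i with h | h
    · exact hxi h
    · exact hj (h j ⟨hkj, j.lt_succ_self⟩)
  · have hfin : {f : ℕ → Bool | ∀ j, k ≤ j → f j = false}.Finite := by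
      refine Finite.of_finite_image (f := fun f (j : Fin k) => f j) (toFinite _) ?_
      intro f hf g hg hfg
      ext1 j
      by_cases hj : j < k
      · exact congrFun hfg ⟨j, hj⟩
      · rw [hf j (not_lt.1 hj), hg j (not_lt.1 hj)]
    refine (Finite.pi' fun i => (hT i).union hfin).subset fun x hx i => hx i

/-- The points of `Y` whose whole fibre over `missing T k l` lies in `O`. -/
def fibreInterior {ι Y : Type*} (T : ι → Set (ℕ → Bool)) (O : Set ((ι → ℕ → Bool) × Y))
    (k l : ℕ) : Set Y :=
  {y | ∀ x ∈ missing T k l, (x, y) ∈ O}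

/-- The complement is the projection of a closed set along a compact factor. -/
theorem isOpen_fibreInterior {ι Y : Type*} [TopologicalSpace Y] {T : ι → Set (ℕ → Bool)}
    (hT : ∀ i, (T i).Finite) {O : Set ((ι → ℕ → Bool) × Y)} (hO : IsOpen O) (k l : ℕ) :
    IsOpen (fibreInterior T O k l) := by
  have h : IsClosed (Prod.snd '' (Prod.fst ⁻¹' missing T k l ∩ Oᶜ)) :=
    isClosedMap_snd_of_compactSpace _
      (((isClosed_missing hT k l).preimage continuous_fst).inter hO.isClosed_compl)
  convert h.isOpen_compl
  ext y
  simp [fibreInterior]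

/-- As `l` grows, the compact sets `missing T k l` decrease into a finite set, so one of them
already lies in any open set containing that finite set. -/
theorem exists_subset_fibreInterior {ι Y : Type*} [Finite ι] [TopologicalSpace Y]
    {T : ι → Set (ℕ → Bool)} (hT : ∀ i, (T i).Finite) {O : Set ((ι → ℕ → Bool) × Y)}
    (hO : IsOpen O) (k : ℕ) {F : Set Y} (hF : F.Finite)
    (h : {x | ∀ i, x i ∈ T i ∨ ∀ j, k ≤ j → x i j = false} ×ˢ F ⊆ O) :
    ∃ l, k < l ∧ F ⊆ fibreInterior T O k l := by
  have hanti : Antitone (missing T k) := fun l l' hl x hx i =>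
    (hx i).imp_right fun h j hj => h j ⟨hj.1, hj.2.trans_le hl⟩
  have hopen : IsOpen (⋂ y ∈ F, {x | (x, y) ∈ O}) :=
    hF.isOpen_biInter fun y _ => hO.preimage (by fun_prop : Continuous fun x => (x, y))
  obtain ⟨l, hl⟩ := exists_subset_nhds_of_compactSpace hanti.directed_ge
    (isClosed_missing hT k) (U := ⋂ y ∈ F, {x | (x, y) ∈ O}) fun x hx =>
      hopen.mem_nhds (mem_iInter₂.2 fun y hy => h ⟨(finite_iInter_missing hT k).1 hx, hy⟩)
  refine ⟨max l (k + 1), by omega, fun y hy x hx => ?_⟩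
  exact mem_iInter₂.1 (hl (hanti (le_max_left _ _) hx)) y hy

/-! ### Selection for prescribed coordinates -/

/-- A strictly increasing sequence with `a (n + 1)` beyond `l (a n)` and values in an infinite set. -/
theorem exists_strictMono_le {D : Set ℕ} (hD : D.Infinite) (l : ℕ → ℕ) :
    ∃ a : ℕ → ℕ, StrictMono a ∧ (∀ n, a n ∈ D) ∧ ∀ n, l (a n) ≤ a (n + 1) := by
  choose s hsD hs using fun N => hD.exists_gt N
  let a : ℕ → ℕ := fun n => Nat.rec (s 0) (fun _ p => s (max p (l p))) n
  refine ⟨a, strictMono_nat_of_lt_succ fun n => ?_, fun n => ?_, fun n => ?_⟩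
  · exact (le_max_left _ _).trans_lt (hs (max (a n) (l (a n))))
  · cases n <;> exact hsD _
  · exact (le_max_right _ _).trans (hs (max (a n) (l (a n)))).le

/-- On a product of towers with a space having the Gerlits--Nagy property, members of countably many
covers can be selected so that infinitely many of them form a point-cofinite family, away from
fewer than `μ` exceptional sets but including prescribed finite sets of coordinates. -/
theorem exists_pointCofinite_selection {μ : Cardinal.{0}} (hμ : ℵ₀ ≤ μ)
    {ι Y : Type*} [Fintype ι] [TopologicalSpace Y] [T1Space Y] (hY : HasGamma Y)
    (X : ι → Set (Set ℕ))
    (hX : ∀ i, ∀ a : ℕ → ℕ, StrictMono a → ∃ b : Set ℕ, b.Infinite ∧ ∃ S : Set (Set ℕ), #S < μ ∧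
        ∀ x ∈ X i \ S, (x ∩ ⋃ n ∈ b, Ico (a n) (a (n + 1))).Finite)
    {T : ι → Set (ℕ → Bool)} (hT : ∀ i, (T i).Finite) (hTX : ∀ i, T i ⊆ withFin (X i))
    (O : ℕ → Set (Set ((ι → ℕ → Bool) × Y))) (hOo : ∀ n, ∀ A ∈ O n, IsOpen A)
    (hO : ∀ n, ∀ F : Set ((ι → ℕ → Bool) × Y), F.Finite → (∀ p ∈ F, ∀ i, p.1 i ∈ withFin (X i)) →
      ∃ A ∈ O n, F ⊆ A) :
    ∃ A : Set ℕ, A.Infinite ∧ ∃ g : ℕ → Set ((ι → ℕ → Bool) × Y), (∀ n, g n ∈ O n) ∧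
      ∃ S : Set (Set ℕ), #S < μ ∧ ∀ (x : ι → ℕ → Bool) (y : Y),
        (∀ i, x i ∈ T i ∨ x i ∈ withFin (X i) ∧ {n | x i n = true} ∉ S) →
          {n ∈ A | (x, y) ∉ g n}.Finite := by
  let W : ℕ → Set (Set Y) := fun k => {V | ∃ U ∈ O k, ∃ l, k < l ∧ V = fibreInterior T U k l}
  obtain ⟨D, w, hD, hw, hDw⟩ := hY.exists_partial_selection W
    (by rintro k _ ⟨U, hU, l, -, rfl⟩; exact isOpen_fibreInterior hT (hOo k U hU) k l) (by
      intro k F hF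
      obtain ⟨U, hU, hFU⟩ := hO k _ ((finite_iInter_missing hT k).2.prod hF) (by
        rintro p ⟨hp, -⟩ i
        refine (hp i).elim (fun h => hTX i h) fun h => .inr ?_
        refine (finite_lt_nat k).subset fun j hj => ?_
        by_contra hjk
        have := h j (not_lt.1 hjk)
        rw [mem_ofPred_eq, this] at hj
        cases hj)
      obtain ⟨l, hkl, hl⟩ := exists_subset_fibreInterior hT (hOo k U hU) k hF hFU
      exact ⟨_, ⟨U, hU, l, hkl, rfl⟩, hl⟩)
  choose g hg l _ hwl using hw
  obtain ⟨a, ha, haD, hal⟩ := exists_strictMono_le hD l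
  obtain ⟨b, hb, S, hS, hbS⟩ := exists_common_intervals hμ X hX Finset.univ a ha
  refine ⟨a '' b, hb.image ha.injective.injOn, g, hg, S, hS, fun x y hx => ?_⟩
  have hint : ∀ i, ∀ᶠ n in atTop, n ∈ b → (x i ∈ T i ∨ ∀ j ∈ Ico (a n) (a (n + 1)), x i j = false) := by
    intro i
    rcases hx i with h | ⟨hxi, hxS⟩
    · exact .of_forall fun _ _ => .inl h
    · have hfin : ({n | x i n = true} ∩ ⋃ n ∈ b, Ico (a n) (a (n + 1))).Finite := by
        rcases hxi with h | h
        · exact hbS i (Finset.mem_univ i) _ ⟨h, hxS⟩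
        · exact h.subset inter_subset_left
      obtain ⟨N, hN⟩ := hfin.bddAbove
      filter_upwards [eventually_gt_atTop N] with n hn hnb
      refine .inr fun j hj => ?_
      by_contra hne
      have h1 := hN ⟨Bool.eq_true_of_not_eq_false hne, mem_biUnion hnb hj⟩
      have h2 := ha.le_apply (x := n)
      have h3 := hj.1
      omega
  obtain ⟨N, hN⟩ := eventually_atTop.1 (eventually_all.2 hint)
  refine ((hDw y).union (finite_le_nat (a N))).subset ?_
  rintro _ ⟨⟨n, hnb, rfl⟩, hn⟩
  by_contra h
  simp only [mem_union, mem_ofPred_eq, not_or, not_and, not_not, not_le] at h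
  refine hn ?_
  have hy := h.1 (haD n)
  rw [hwl] at hy
  refine hy x fun i => ?_
  -- Since `l (a n) ≤ a (n + 1)`, missing the whole interval of `a` suffices.
  refine (hN n (ha.lt_iff_lt.1 h.2).le i hnb).imp_right fun h j hj => h j ⟨hj.1, hj.2.trans_le (hal n)⟩

theorem mainTheorem5 (κ : Ordinal.{0}) (hκ_uncountable : ℵ₀ < κ.card)
    (hκ_le : κ ≤ covMeager.ord)
    (hκ : κ.cof.ord = κ ∨ κ < covMeager.ord)
    (m : ℕ) (X : Fin m → Set (Set ℕ)) (hX : ∀ i, IsGeneralizedTower κ (X i))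
    (Y : Type*) [TopologicalSpace Y] (hY_reals : IsSetOfReals Y) (hY : HasGamma Y) :
    SelectOne (OmegaCovers ((∀ i : Fin m, withFin (X i)) × Y))
      (OmegaCovers ((∀ i : Fin m, withFin (X i)) × Y)) := by
  classical
  obtain ⟨μ, hμ, hμ₀, hμcov, hκμ⟩ := exists_regular_bound hκ_uncountable hκ_le hκ
  obtain ⟨r, hr⟩ := hY_reals
  have : T1Space Y := hr.t1Space
  have : SecondCountableTopology Y := hr.secondCountableTopology
  intro U hU
  choose u huU hu using fun n => OmegaCovers.exists_enumerated_subcover (hU n)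
  let e : (∀ i : Fin m, withFin (X i)) × Y → (Fin m → ℕ → Bool) × Y := fun p => (fun i => p.1 i, p.2)
  have he : IsInducing e :=
    (IsInducing.piMap fun i : Fin m => (IsInducing.subtypeVal (t := withFin (X i)))).prodMap .id
  have heinj : Function.Injective e := fun p q hpq =>
    Prod.ext (funext fun i => Subtype.ext (congrFun (congrArg (fun z => z.1) hpq) i))
      (congrArg (fun z => z.2) hpq)
  have hext : ∀ n k, ∃ O, IsOpen O ∧ e ⁻¹' O = u n k := fun n k =>
    he.isOpen_iff.1 ((hU n).1.1 _ (huU n k)).1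
  choose O hOo hO using hext
  have hX' : ∀ i, ∀ a : ℕ → ℕ, StrictMono a → ∃ b : Set ℕ, b.Infinite ∧ ∃ S : Set (Set ℕ), #S < μ ∧
        ∀ x ∈ X i \ S, (x ∩ ⋃ n ∈ b, Ico (a n) (a (n + 1))).Finite := fun i a ha =>
    let ⟨b, hb, S, _, hS, h⟩ := (hX i).2.2 a ha
    ⟨b, hb, S, hκμ _ hS, h⟩
  have hsupp : Function.Injective fun f : ℕ → Bool => {n | f n = true} := fun f g hfg =>
    funext fun n => Bool.eq_iff_iff.2 (Set.ext_iff.1 hfg n)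
  have hpiece : ∀ T : Finset (Set ℕ), ∃ A : Set ℕ, A.Infinite ∧ ∃ g : ℕ → ℕ,
      ∃ S : Set (Set ℕ), #S < μ ∧ ∀ p : (∀ i : Fin m, withFin (X i)) × Y,
        (∀ i, {n | (p.1 i).1 n = true} ∈ T ∨ {n | (p.1 i).1 n = true} ∉ S) →
          {n ∈ A | p ∉ u n (g n)}.Finite := by
    intro T
    obtain ⟨A, hA, g, hg, S, hS, h⟩ := exists_pointCofinite_selection hμ₀.le hY X hX'
      (T := fun i => {f | {n | f n = true} ∈ T} ∩ withFin (X i))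
      (fun i => (T.finite_toSet.preimage hsupp.injOn).inter_of_left _)
      (fun i => inter_subset_right) (fun n => range (O n))
      (by rintro n _ ⟨k, rfl⟩; exact hOo n k) (by
        intro n F hF hFX
        obtain ⟨k, hk⟩ := hu n (e ⁻¹' F) (hF.preimage heinj.injOn)
        refine ⟨_, ⟨k, rfl⟩, fun p hp => ?_⟩
        have : (⟨fun i => ⟨p.1 i, hFX p hp i⟩, p.2⟩ : (∀ i : Fin m, withFin (X i)) × Y) ∈ u n k :=
          hk hp
        rwa [← hO n k] at this)
    choose c hc using hg
    refine ⟨A, hA, c, S, hS, fun p hp => (h (e p).1 (e p).2 fun i => ?_).subset fun n hn => ⟨hn.1, ?_⟩⟩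
    · exact (hp i).imp (fun h => ⟨h, (p.1 i).2⟩) fun h => ⟨(p.1 i).2, h⟩
    · rw [← hc]
      have := hn.2
      rwa [← hO] at this
  choose A hA g S hS hgS using hpiece
  obtain ⟨C, hC, hCS⟩ := exists_small_closed_set hμ hμ₀ S hS
  obtain ⟨f, hf⟩ := exists_notMem_of_card_lt_covMeager
    (ι := Finset C) ((mk_finset_lt hμ₀ hC).trans_le hμcov) _
    fun T => isMeagre_setOf_finite_agreement (hA (T.map (.subtype _))) (g (T.map (.subtype _)))
  have hV : ∀ F : Set ((∀ i : Fin m, withFin (X i)) × Y), F.Finite → ∃ n, F ⊆ u n (f n) := by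
    intro F hF
    let E : Set (Set ℕ) := ⋃ i : Fin m, (fun p => {n | (p.1 i).1 n = true}) '' F
    have hE : E.Finite := finite_iUnion fun i => hF.image _
    let T : Finset C := hE.toFinset.subtype (· ∈ C)
    have hbad : {n ∈ A (T.map (.subtype _)) | ¬ F ⊆ u n (g (T.map (.subtype _)) n)}.Finite := by
      refine (hF.biUnion fun p hp => hgS (T.map (.subtype _)) p fun i => ?_).subset ?_
      · have hpE : {n | (p.1 i).1 n = true} ∈ E := mem_iUnion.2 ⟨i, p, hp, rfl⟩
        by_cases hpC : {n | (p.1 i).1 n = true} ∈ C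
        · left
          simpa [T, hpC] using hpE
        · right
          refine fun h => hpC (hCS _ ?_ h)
          intro s hs
          obtain ⟨t, -, rfl⟩ := Finset.mem_map.1 hs
          exact t.2
      · rintro n ⟨hnA, hn⟩
        obtain ⟨p, hp, hpn⟩ := not_subset.1 hn
        exact mem_biUnion hp ⟨hnA, hpn⟩
    obtain ⟨n, ⟨hnA, hn⟩, hn'⟩ := (Set.Infinite.sdiff (hf T) hbad).nonempty
    refine ⟨n, ?_⟩
    by_contra h
    exact hn' ⟨hnA, hn ▸ h⟩
  refine ⟨fun n => u n (f n), fun n => huU n _, ⟨?_, ?_⟩, fun F hF => ?_⟩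
  · rintro _ ⟨n, rfl⟩
    exact (hU n).1.1 _ (huU n _)
  · refine eq_univ_of_forall fun p => ?_
    obtain ⟨n, hn⟩ := hV {p} (finite_singleton p)
    exact ⟨_, ⟨n, rfl⟩, hn rfl⟩
  · obtain ⟨n, hn⟩ := hV F hF
    exact ⟨_, ⟨n, rfl⟩, hn⟩
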